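/- Let $R$ be a commutative Noetherian ring, let $I, J$ be ideals of $R$, and let $M$ be a finitely generated $R$-module. For a finitely generated $R$-module $K$ write $h_K=\operatorname{Hom}_R(K,-)$, and let $F$ be an $R$-linear covariant functor from the category of finitely generated $R$-modules to itself that is coherent, i.e. there are finitely generated $R$-modules $K, L$ and an exact sequence of functors $h_L\to h_K\to F\to 0$. For a finitely generated $R$-module $N$ let $\operatorname{depth}_J N$ be $\infty$ if $JN=N$, and otherwise the supremum of the lengths of the $N$-regular sequences contained in $J$. Then each of the following sequences, indexed by $n$, is eventually constant: $$\operatorname{Ass}_R F(M/I^nM),\quad \operatorname{Ass}_R F(I^{n-1}M/I^nM),\quad \operatorname{depth}_J F(M/I^nM),\quad \operatorname{depth}_J F(I^{n-1}M/I^nM).$$ More generally, for every submodule $M'\subseteq M$ each of the following sequences is eventually constant: $$\operatorname{Ass}_R F(M/I^nM'),\quad \operatorname{Ass}_R F(I^nM/I^nM'),\quad \operatorname{depth}_J F(M/I^nM'),\quad \operatorname{depth}_J F(I^nM/I^nM').$$ -/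

import Mathlib

open CategoryTheory

universe u v

noncomputable section

namespace AsymptoticStability

/-- The elements `x n` stabilize: the sequence `x` is eventually constant. -/
def Stabilizes {X : Type*} (x : ℕ → X) : Prop :=
  ∃ n₀ : ℕ, ∀ n ≥ n₀, x n = x n₀

/-- For submodules `Q ≤ P` of a module, the module `P / Q`. -/
abbrev Subquotient {R : Type*} [CommRing R] {M : Type*} [AddCommGroup M] [Module R M]
    (P Q : Submodule R M) : Type _ :=
  P ⧸ Q.submoduleOf P

open Classical in
/-- The `J`-depth of a module `N` (intended for finitely generated `N` over a Noetherian ring):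
`∞` if `J N = N`, and otherwise the supremum of the lengths of the `N`-regular sequences whose
terms lie in `J`. -/
def depth {R : Type*} [CommRing R] (J : Ideal R) (N : Type*) [AddCommGroup N] [Module R N] : ℕ∞ :=
  if J • (⊤ : Submodule R N) = ⊤ then ⊤
  else ⨆ (rs : List R) (_ : (∀ r ∈ rs, r ∈ J) ∧ RingTheory.Sequence.IsRegular N rs),
    (rs.length : ℕ∞)

section Coherent

variable {R : Type u} [CommRing R] [IsNoetherianRing R]

/-- The functor `h_M = Hom_R(M, -)` from finitely generated `R`-modules to itself; it takes values
in finitely generated modules because `R` is Noetherian. -/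
def homFunctor (M : FGModuleCat.{v} R) : FGModuleCat.{v} R ⥤ FGModuleCat.{v} R where
  obj N := FGModuleCat.of R (M →ₗ[R] N)
  map {N N'} f := FGModuleCat.ofHom (LinearMap.compRight R (M := M) f.hom.hom)

/-- A functor `F` from finitely generated `R`-modules to itself is coherent if there is an exact
sequence `h_L ⟶ h_K ⟶ F ⟶ 0` with `K` and `L` finitely generated; exactness of a sequence of
functors means exactness at every object. -/
def IsCoherent (F : FGModuleCat.{v} R ⥤ FGModuleCat.{v} R) : Prop :=
  ∃ (L K : FGModuleCat.{v} R) (φ : homFunctor L ⟶ homFunctor K) (ψ : homFunctor K ⟶ F),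
    ∀ X : FGModuleCat.{v} R,
      Function.Exact (φ.app X).hom.hom (ψ.app X).hom.hom ∧
      Function.Surjective (ψ.app X).hom.hom

end Coherent

end AsymptoticStability

end

open AsymptoticStability

/-!
For a coherent functor `F` with presentation `h_L ⟶ h_K ⟶ F ⟶ 0`, the Yoneda lemma gives a linear
map `α : K → L` with `F N = coker (Hom (L, N) → Hom (K, N))`. If `N n = X n / Y n` for submodules
`Y n ≤ X n` of a fixed finitely generated module, then surjections from free modules onto `K` and
`L` describe `F (N n)` as a subquotient of a fixed finitely generated module again
(`nonempty_inducingMaps_equiv`). This description involves only sums, images, finite intersections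
and preimages of the families `X` and `Y`.

The families that occur in the theorem have the form `A + I ^ n B` after an index shift
(`IsReesFamily`). By the Artin–Rees lemma this class is closed under the operations just listed, the
preimages being the only hard case (`IsReesFamily.comap`). It therefore suffices to prove that the
associated primes and the depths of `X n / Y n` stabilize for all such families `X` and `Y`.

*Associated primes.* The family `{w ∈ X n | p w ⊆ Y n}` is of the same form, and `p` is associated
to `X n / Y n` exactly if this submodule does not vanish modulo `Y n` after localization at `p`. For
`A + I ^ n B` and `A' + I ^ n B'`, this vanishing is a condition on `A` that passes to smaller `n`
together with a condition on `I ^ n B` that passes to larger `n`. So for each `p` the answer is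
eventually constant (`IsReesFamily.stabilizes_mem_associatedPrimes`). Only finitely many `p` ever
occur, because `⨁ I ^ n B / I ^ (n + 1) B` is a finitely generated module over the Rees algebra and
its associated primes contract to the primes in question
(`finite_setOf_prime_eq_colon_sup_pow_smul`).

*Depth.* Depth drops by one modulo a regular element (`depth_eq_depth_quotSMulTop_add_one`); this
is proved by an elementary exchange argument for regular sequences. Since the associated primes
stabilize, either no element of `J` is regular on `X n / Y n` for large `n`, or some element
`z ∈ J` is regular on all of these modules, and then `X n / (Y n + z X n)` is a family of the same
kind. Noetherian induction on the ideal generated by such elements finishes the proof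
(`IsReesFamily.stabilizes_depth`).
-/

namespace AsymptoticStability

open Pointwise

/-! ### Families of submodules of Rees type -/

section ReesFamily

variable {R : Type*} [CommRing R] (I : Ideal R)
variable {V W : Type*} [AddCommGroup V] [Module R V] [AddCommGroup W] [Module R W]

/-- A sequence of submodules of a fixed module is of Rees type with respect to `I` if, from some
index `c` on, it is of the form `X (c + n) = A + I ^ n B` with fixed submodules `A` and `B`. -/
def IsReesFamily (X : ℕ → Submodule R W) : Prop :=
  ∃ (c : ℕ) (A B : Submodule R W), ∀ n, X (c + n) = A ⊔ I ^ n • B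

variable {I}

namespace IsReesFamily

variable {X Y : ℕ → Submodule R W}

lemma const (A : Submodule R W) : IsReesFamily I fun _ ↦ A :=
  ⟨0, A, ⊥, fun n ↦ by simp⟩

lemma pow_smul (B : Submodule R W) : IsReesFamily I fun n ↦ I ^ n • B :=
  ⟨0, ⊥, B, fun n ↦ by simp⟩

/-- The starting index of a family of Rees type may be enlarged. -/
lemma exists_add (hX : IsReesFamily I X) :
    ∃ c : ℕ, ∀ d, ∃ A B : Submodule R W, ∀ n, X (c + d + n) = A ⊔ I ^ n • B := by
  obtain ⟨c, A, B, h⟩ := hX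
  refine ⟨c, fun d ↦ ⟨A, I ^ d • B, fun n ↦ ?_⟩⟩
  rw [add_assoc, h, add_comm d n, pow_add, ← smul_eq_mul, Submodule.smul_assoc]

lemma sup (hX : IsReesFamily I X) (hY : IsReesFamily I Y) :
    IsReesFamily I fun n ↦ X n ⊔ Y n := by
  obtain ⟨c, hc⟩ := hX.exists_add
  obtain ⟨d, hd⟩ := hY.exists_add
  obtain ⟨A, B, h⟩ := hc d
  obtain ⟨A', B', h'⟩ := hd c
  refine ⟨c + d, A ⊔ A', B ⊔ B', fun n ↦ ?_⟩
  dsimp only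
  rw [h, add_comm c d, h', Submodule.smul_sup, sup_sup_sup_comm]

lemma map (f : W →ₗ[R] V) (hX : IsReesFamily I X) :
    IsReesFamily I fun n ↦ (X n).map f := by
  obtain ⟨c, A, B, h⟩ := hX
  exact ⟨c, A.map f, B.map f, fun n ↦ by
    dsimp only; rw [h, Submodule.map_sup, Submodule.map_smul'']⟩

/-- Artin–Rees lemma for the preimage of the sequence `I ^ n B`. -/
lemma comap_pow_smul [IsNoetherianRing R] [Module.Finite R V] (f : W →ₗ[R] V)
    (B : Submodule R V) : IsReesFamily I fun n ↦ (I ^ n • B).comap f := by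
  obtain ⟨k, hk⟩ := I.exists_pow_inf_eq_pow_smul ((LinearMap.range f).submoduleOf B)
  have key : ∀ n, (I ^ n • B) ⊓ LinearMap.range f =
      ((I ^ n • ⊤ ⊓ (LinearMap.range f).submoduleOf B : Submodule R B)).map B.subtype := by
    intro n
    rw [Submodule.map_inf _ B.injective_subtype, Submodule.map_smul'', Submodule.map_top,
      Submodule.range_subtype, Submodule.submoduleOf, Submodule.map_comap_subtype, ← inf_assoc,
      inf_eq_left.2 (Submodule.smul_le_right : I ^ n • B ≤ B)]
  refine ⟨k, LinearMap.ker f, (I ^ k • B).comap f, fun n ↦ ?_⟩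
  have h1 : ((I ^ (k + n) • B).comap f).map f = (I ^ n • (I ^ k • B).comap f).map f := by
    rw [Submodule.map_smul'', Submodule.map_comap_eq, Submodule.map_comap_eq, inf_comm, key,
      hk _ (Nat.le_add_right k n), Nat.add_sub_cancel_left, Submodule.map_smul'', ← key, inf_comm]
  have h2 := congrArg (Submodule.comap f) h1
  rw [Submodule.comap_map_eq, Submodule.comap_map_eq] at h2
  rw [sup_comm, ← h2, eq_comm, sup_eq_left]
  exact LinearMap.ker_le_comap f

lemma comap [IsNoetherianRing R] [Module.Finite R V] (f : W →ₗ[R] V) {X : ℕ → Submodule R V}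
    (hX : IsReesFamily I X) : IsReesFamily I fun n ↦ (X n).comap f := by
  obtain ⟨c, A, B, h⟩ := hX
  -- Passing to the quotient by `A` reduces to the sequence `I ^ n B`.
  obtain ⟨d, A', B', h'⟩ := comap_pow_smul (I := I) (A.mkQ ∘ₗ f) (B.map A.mkQ)
  refine ⟨c + d, A', B', fun n ↦ ?_⟩
  dsimp only at h' ⊢
  rw [← h', add_assoc, h, Submodule.comap_comp, ← Submodule.map_smul'', Submodule.comap_map_mkQ]

lemma inf [IsNoetherianRing R] [Module.Finite R W] (hX : IsReesFamily I X)
    (hY : IsReesFamily I Y) : IsReesFamily I fun n ↦ X n ⊓ Y n := by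
  have h := ((hX.map (LinearMap.inl R W W)).sup (hY.map (LinearMap.inr R W W))).comap
    (LinearMap.prod LinearMap.id LinearMap.id)
  convert h using 2 with n
  ext w
  simp only [Submodule.mem_inf, Submodule.mem_comap, Submodule.mem_sup, Submodule.mem_map,
    exists_exists_and_eq_and, LinearMap.prod_apply, LinearMap.inl_apply, LinearMap.inr_apply]
  constructor
  · rintro ⟨h1, h2⟩
    exact ⟨w, h1, w, h2, by simp⟩
  · rintro ⟨a, ha, b, hb, hab⟩
    simp only [Prod.mk_add_mk, add_zero, zero_add, Function.prod, LinearMap.id_apply,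
      Prod.mk.injEq] at hab
    obtain ⟨rfl, rfl⟩ := hab
    exact ⟨ha, hb⟩

lemma finset_inf [IsNoetherianRing R] [Module.Finite R W] {ι : Type*} (s : Finset ι)
    {X : ι → ℕ → Submodule R W} (hX : ∀ i, IsReesFamily I (X i)) :
    IsReesFamily I fun n ↦ s.inf fun i ↦ X i n := by
  classical
  induction s using Finset.induction_on with
  | empty => simpa using const (I := I) (⊤ : Submodule R W)
  | insert a s _ ih => simpa only [Finset.inf_insert] using (hX a).inf ih

lemma smul (J : Ideal R) (hX : IsReesFamily I X) : IsReesFamily I fun n ↦ J • X n := by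
  obtain ⟨c, A, B, h⟩ := hX
  refine ⟨c, J • A, J • B, fun n ↦ ?_⟩
  dsimp only
  rw [h, Submodule.smul_sup, ← Submodule.smul_assoc, ← Submodule.smul_assoc, smul_eq_mul,
    smul_eq_mul, mul_comm]

/-- The sequence of the submodules `{w | p w ⊆ X n}`. -/
lemma ideal_smul_mem [IsNoetherianRing R] [Module.Finite R W] (p : Ideal R)
    (hX : IsReesFamily I X) :
    ∃ Z : ℕ → Submodule R W, IsReesFamily I Z ∧ ∀ n w, w ∈ Z n ↔ ∀ a ∈ p, a • w ∈ X n := by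
  obtain ⟨s, hs⟩ := (isNoetherianRing_iff_ideal_fg R).1 ‹_› p
  refine ⟨_, finset_inf s fun a ↦ hX.comap (LinearMap.lsmul R W a), fun n w ↦ ?_⟩
  simp only [Submodule.mem_finsetInf, Submodule.mem_comap, LinearMap.lsmul_apply]
  constructor
  · intro h a ha
    have hle : p ≤ (X n).comap (LinearMap.toSpanSingleton R W w) := by
      rw [← hs]
      exact Submodule.span_le.2 fun a ha ↦ h a ha
    exact hle ha
  · intro h a ha
    exact h a (hs ▸ Submodule.subset_span ha)

end IsReesFamily

end ReesFamily

/-! ### Eventually constant sequences -/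

section Stabilizes

variable {α β γ : Type*}

lemma Stabilizes.of_eventually_const {x : ℕ → α} {a : α} (n₀ : ℕ) (h : ∀ n ≥ n₀, x n = a) :
    Stabilizes x :=
  ⟨n₀, fun n hn ↦ (h n hn).trans (h n₀ le_rfl).symm⟩

lemma Stabilizes.congr {x y : ℕ → α} (hx : Stabilizes x) (n₀ : ℕ) (h : ∀ n ≥ n₀, y n = x n) :
    Stabilizes y := by
  obtain ⟨m, hm⟩ := hx
  refine .of_eventually_const (max m n₀) (a := x m) fun n hn ↦ ?_
  rw [h n (le_of_max_le_right hn), hm n (le_of_max_le_left hn)]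

lemma Stabilizes.of_add {x : ℕ → α} (c : ℕ) (hx : Stabilizes fun n ↦ x (c + n)) :
    Stabilizes x := by
  obtain ⟨m, hm⟩ := hx
  refine .of_eventually_const (c + m) (a := x (c + m)) fun n hn ↦ ?_
  have := hm (n - c) (by omega)
  dsimp only at this
  rwa [Nat.add_sub_cancel' (by omega)] at this

lemma Stabilizes.map₂ {x : ℕ → α} {y : ℕ → β} (f : α → β → γ) (hx : Stabilizes x)
    (hy : Stabilizes y) : Stabilizes fun n ↦ f (x n) (y n) := by
  obtain ⟨m, hm⟩ := hx
  obtain ⟨k, hk⟩ := hy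
  refine .of_eventually_const (max m k) (a := f (x m) (y k)) fun n hn ↦ ?_
  rw [hm n (le_of_max_le_left hn), hk n (le_of_max_le_right hn)]

lemma Stabilizes.map {x : ℕ → α} (f : α → β) (hx : Stabilizes x) :
    Stabilizes fun n ↦ f (x n) :=
  hx.map₂ (fun a _ ↦ f a) hx

lemma stabilizes_of_imp_succ {P : ℕ → Prop} (h : ∀ n, P n → P (n + 1)) : Stabilizes P := by
  by_cases hP : ∃ n, P n
  · obtain ⟨n, hn⟩ := hP
    refine .of_eventually_const n (a := True) fun m hm ↦ eq_true ?_
    induction m, hm using Nat.le_induction with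
    | base => exact hn
    | succ m _ ih => exact h m ih
  · exact .of_eventually_const 0 (a := False) fun m _ ↦ eq_false fun hm ↦ hP ⟨m, hm⟩

lemma stabilizes_of_succ_imp {P : ℕ → Prop} (h : ∀ n, P (n + 1) → P n) : Stabilizes P := by
  have := (stabilizes_of_imp_succ (P := fun n ↦ ¬ P n) fun n hn hn' ↦ hn (h n hn')).map Not
  simpa only [not_not] using this

/-- A sequence of subsets of a finite set stabilizes if membership of each element does. -/
lemma stabilizes_of_forall_mem {s : ℕ → Set α} {t : Set α} (ht : t.Finite) (hst : ∀ n, s n ⊆ t)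
    (h : ∀ a, Stabilizes fun n ↦ a ∈ s n) : Stabilizes s := by
  choose m hm using h
  obtain ⟨N, hN⟩ := (ht.image m).bddAbove
  refine ⟨N, fun n hn ↦ Set.ext fun a ↦ ?_⟩
  by_cases ha : a ∈ t
  · have hmN : m a ≤ N := hN ⟨a, ha, rfl⟩
    exact iff_of_eq ((hm a n (hmN.trans hn)).trans (hm a N hmN).symm)
  · exact ⟨fun h ↦ (ha (hst n h)).elim, fun h ↦ (ha (hst N h)).elim⟩

end Stabilizes

/-! ### Associated primes of subquotients of Rees type -/

section AssociatedPrimes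

variable {R : Type*} [CommRing R] {W : Type*} [AddCommGroup W] [Module R W]

/-- The saturation of a submodule `Y` at a prime `p`: the elements whose images lie in the
localization of `Y` at `p`. -/
def saturationAt (p : Ideal R) [hp : p.IsPrime] (Y : Submodule R W) : Submodule R W where
  carrier := {w | ∃ s ∉ p, s • w ∈ Y}
  zero_mem' := ⟨1, p.ne_top_iff_one.1 hp.ne_top, by simp⟩
  add_mem' := by
    rintro v w ⟨s, hs, hv⟩ ⟨t, ht, hw⟩
    refine ⟨s * t, fun h ↦ (hp.mem_or_mem h).elim hs ht, ?_⟩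
    rw [smul_add]
    refine Y.add_mem ?_ ?_
    · rw [mul_comm, mul_smul]
      exact Y.smul_mem t hv
    · rw [mul_smul]
      exact Y.smul_mem s hw
  smul_mem' := by
    rintro a w ⟨s, hs, hw⟩
    exact ⟨s, hs, by rw [smul_comm]; exact Y.smul_mem a hw⟩

lemma mem_saturationAt {p : Ideal R} [p.IsPrime] {Y : Submodule R W} {w : W} :
    w ∈ saturationAt p Y ↔ ∃ s ∉ p, s • w ∈ Y := Iff.rfl

lemma saturationAt_mono (p : Ideal R) [p.IsPrime] {Y Y' : Submodule R W} (h : Y ≤ Y') :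
    saturationAt p Y ≤ saturationAt p Y' :=
  fun _ ⟨s, hs, hw⟩ ↦ ⟨s, hs, h hw⟩

lemma smul_saturationAt_le (I p : Ideal R) [p.IsPrime] (Y : Submodule R W) :
    I • saturationAt p Y ≤ saturationAt p (I • Y) := by
  refine Submodule.smul_le.2 fun a ha w ⟨s, hs, hw⟩ ↦ ⟨s, hs, ?_⟩
  rw [smul_comm]
  exact Submodule.smul_mem_smul ha hw

lemma mem_associatedPrimes_subquotient [IsNoetherianRing R] {X Y : Submodule R W} {p : Ideal R} :
    p ∈ associatedPrimes R (Subquotient X Y) ↔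
      p.IsPrime ∧ ∃ w ∈ X, ∀ a, a ∈ p ↔ a • w ∈ Y := by
  rw [AssociatedPrimes.mem_iff, isAssociatedPrime_iff, and_congr_right_iff]
  intro _
  rw [(Submodule.mkQ_surjective _).exists, Subtype.exists]
  refine exists_congr fun w ↦ ?_
  rw [← exists_prop]
  refine exists_congr fun hw ↦ ?_
  rw [SetLike.ext_iff]
  refine forall_congr' fun a ↦ ?_
  rw [Submodule.mem_colon_singleton, ← map_smul, Submodule.mem_bot, Submodule.mkQ_apply,
    Submodule.Quotient.mk_eq_zero, Submodule.submoduleOf, Submodule.mem_comap]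
  simp

/-- For a fixed prime `p`, whether `p` is associated to `X n / Y n` is eventually constant:
it fails exactly if `{w ∈ X n | p w ⊆ Y n}` lies in the saturation of `Y n` at `p`. That sequence
is `A + I ^ n B` for large `n`; the condition on `A` is inherited by smaller `n` and the one
on `I ^ n B` by larger `n`. -/
lemma IsReesFamily.stabilizes_mem_associatedPrimes [IsNoetherianRing R] [Module.Finite R W]
    {I : Ideal R} {X Y : ℕ → Submodule R W} (hX : IsReesFamily I X) (hY : IsReesFamily I Y)
    (p : Ideal R) : Stabilizes fun n ↦ p ∈ associatedPrimes R (Subquotient (X n) (Y n)) := by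
  by_cases hp : p.IsPrime
  swap
  · exact .of_eventually_const 0 (a := False) fun n _ ↦ eq_false fun h ↦ hp h.isPrime
  obtain ⟨Z, hZ, hZY⟩ := hY.ideal_smul_mem p
  have key : ∀ n, p ∈ associatedPrimes R (Subquotient (X n) (Y n)) ↔
      ¬ X n ⊓ Z n ≤ saturationAt p (Y n) := by
    intro n
    rw [mem_associatedPrimes_subquotient, and_iff_right hp, SetLike.not_le_iff_exists]
    refine exists_congr fun w ↦ ?_
    rw [Submodule.mem_inf, hZY, mem_saturationAt, and_assoc, and_congr_right_iff]
    intro _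
    constructor
    · intro h
      exact ⟨fun a ↦ (h a).1, fun ⟨s, hs, hsw⟩ ↦ hs ((h s).2 hsw)⟩
    · intro h a
      exact ⟨h.1 a, fun haw ↦ by_contra fun ha ↦ h.2 ⟨a, ha, haw⟩⟩
  simp only [key]
  refine Stabilizes.map Not ?_
  obtain ⟨c, hc⟩ := (hX.inf hZ).exists_add
  obtain ⟨d, hd⟩ := hY.exists_add
  obtain ⟨A, B, h⟩ := hc d
  obtain ⟨A', B', h'⟩ := hd c
  refine .of_add (c + d) ?_
  replace h : ∀ n, X (c + d + n) ⊓ Z (c + d + n) = A ⊔ I ^ n • B := h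
  rw [add_comm d c] at h'
  simp only [h, h', sup_le_iff]
  refine Stabilizes.map₂ And (stabilizes_of_succ_imp fun n hn ↦ hn.trans ?_)
    (stabilizes_of_imp_succ fun n hn ↦ ?_)
  · refine saturationAt_mono p (sup_le_sup_left ?_ _)
    exact Submodule.smul_mono_left (Ideal.pow_le_pow_right n.le_succ)
  · rw [pow_succ', ← smul_eq_mul, Submodule.smul_assoc]
    refine (smul_mono_right I hn).trans ((smul_saturationAt_le I p _).trans ?_)
    refine saturationAt_mono p ?_
    rw [Submodule.smul_sup, Submodule.smul_assoc]
    exact sup_le_sup_right Submodule.smul_le_right _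

/-- A prime of `R` which is the annihilator of an element of an `S`-module is the contraction of an
associated prime over `S`. -/
lemma exists_comap_eq_of_colon_eq {S N : Type*} [CommRing S] [Algebra R S] [IsNoetherianRing S]
    [AddCommGroup N] [Module R N] [Module S N] [IsScalarTower R S N]
    {p : Ideal R} [hp : p.IsPrime] {x : N} (h : ∀ a : R, a ∈ p ↔ a • x = 0) :
    ∃ q ∈ associatedPrimes S N, q.comap (algebraMap R S) = p := by
  have hcomap : ((⊥ : Submodule S N).colon {x}).comap (algebraMap R S) = p := by
    ext a
    rw [Ideal.mem_comap, Submodule.mem_colon_singleton, algebraMap_smul, h, Submodule.mem_bot]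
  obtain ⟨q, hq, hqp⟩ := Ideal.exists_minimalPrimes_comap_eq (algebraMap R S) p
    (I := (⊥ : Submodule S N).colon {x})
    (by rw [hcomap, Ideal.minimalPrimes_eq_subsingleton_self]; rfl)
  refine ⟨q, ?_, hqp⟩
  rw [AssociatedPrimes.mem_iff, isAssociatedPrime_iff]
  exact ⟨hq.1.1, Submodule.exists_eq_colon_of_mem_minimalPrimes hq⟩

/-- The primes which are annihilators of elements of `I ^ n B / I ^ (n + 1) B` for some `n` form
a finite set, since the sum of these modules is finitely generated over the Rees algebra. -/
lemma finite_setOf_prime_eq_colon_pow_smul [IsNoetherianRing R] [Module.Finite R W] (I : Ideal R)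
    (B : Submodule R W) :
    {p : Ideal R | p.IsPrime ∧ ∃ n, ∃ w ∈ I ^ n • B, ∀ a, a ∈ p ↔ a • w ∈ I ^ (n + 1) • B}.Finite
    := by
  let F := I.stableFiltration B
  let G := I.stableFiltration (I • B)
  have hG : ∀ n, G.N n = I ^ (n + 1) • B := fun n ↦ by
    simp only [G, Ideal.stableFiltration_N]
    rw [← Submodule.smul_assoc, smul_eq_mul, ← pow_succ]
  have hfg : F.submodule.FG :=
    (F.submodule_fg_iff_stable fun _ ↦ IsNoetherian.noetherian _).2 (I.stableFiltration_stable B)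
  have : Module.Finite (reesAlgebra I) F.submodule := Module.Finite.iff_fg.2 hfg
  refine ((associatedPrimes.finite (reesAlgebra I)
    (Subquotient F.submodule G.submodule)).image
      (Ideal.comap (algebraMap R (reesAlgebra I)))).subset ?_
  rintro p ⟨hp, n, w, hw, h⟩
  have single_mem : ∀ (E : I.Filtration W) (v : W),
      PolynomialModule.single R n v ∈ E.submodule ↔ v ∈ E.N n := by
    intro E v
    rw [Ideal.Filtration.mem_submodule]
    refine ⟨fun h ↦ by simpa using h n, fun hv i ↦ ?_⟩
    rw [PolynomialModule.coeff_single, Finsupp.single_apply]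
    split_ifs with hi
    · exact hi ▸ hv
    · exact zero_mem _
  let x : F.submodule := ⟨PolynomialModule.single R n w, (single_mem F w).2 hw⟩
  refine exists_comap_eq_of_colon_eq (x := Submodule.Quotient.mk x) fun a ↦ ?_
  rw [h, ← Submodule.Quotient.mk_smul, Submodule.Quotient.mk_eq_zero, Submodule.submoduleOf,
    Submodule.mem_comap, ← hG, ← single_mem, PolynomialModule.single_smul]
  rfl

/-- The primes of the form `Y n : w` for a family `Y` of Rees type are finite in number. If
`s w ∈ Y n` for some `s` outside of `p = Y (n + 1) : w`, then `p` is also the annihilator of the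
class of `s w` in `Y n / Y (n + 1)`; otherwise `p = Y n : w`. -/
lemma finite_setOf_prime_eq_colon_sup_pow_smul [IsNoetherianRing R] [Module.Finite R W]
    (I : Ideal R) (A B : Submodule R W) :
    {p : Ideal R | p.IsPrime ∧ ∃ n w, ∀ a, a ∈ p ↔ a • w ∈ A ⊔ I ^ n • B}.Finite := by
  have hgr := finite_setOf_prime_eq_colon_pow_smul I (B.map A.mkQ)
  have h0 := associatedPrimes.finite R (Subquotient (⊤ : Submodule R W) (A ⊔ I ^ 0 • B))
  refine (h0.union hgr).subset ?_
  rintro p ⟨hp, n, w, h⟩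
  induction n generalizing w with
  | zero => exact Or.inl (mem_associatedPrimes_subquotient.2 ⟨hp, w, Submodule.mem_top, h⟩)
  | succ n ih =>
    by_cases hs : ∃ s ∉ p, s • w ∈ A ⊔ I ^ n • B
    · obtain ⟨s, hs, hsw⟩ := hs
      have hmap : ∀ (m : ℕ) (v : W),
          A.mkQ v ∈ I ^ m • B.map A.mkQ ↔ v ∈ A ⊔ I ^ m • B := fun m v ↦ by
        rw [← Submodule.map_smul'', ← Submodule.comap_map_mkQ, Submodule.mem_comap]
      refine Or.inr ⟨hp, n, A.mkQ (s • w), (hmap n _).2 hsw, fun a ↦ ?_⟩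
      rw [← map_smul, hmap, smul_smul, ← h]
      exact ⟨fun ha ↦ p.mul_mem_right s ha, fun has ↦ (hp.mem_or_mem has).resolve_right hs⟩
    · refine ih w fun a ↦ ⟨fun ha ↦ ?_, fun ha ↦ by_contra fun hap ↦ hs ⟨a, hap, ha⟩⟩
      have hle : I ^ (n + 1) • B ≤ I ^ n • B :=
        Submodule.smul_mono_left (Ideal.pow_le_pow_right n.le_succ)
      exact sup_le_sup_left hle A ((h a).1 ha)

/-- The associated primes of the subquotients `X n / Y n` stabilize if `X` and `Y` are of Rees
type. -/
theorem IsReesFamily.stabilizes_associatedPrimes [IsNoetherianRing R] [Module.Finite R W]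
    {I : Ideal R} {X Y : ℕ → Submodule R W} (hX : IsReesFamily I X) (hY : IsReesFamily I Y) :
    Stabilizes fun n ↦ associatedPrimes R (Subquotient (X n) (Y n)) := by
  obtain ⟨c, A, B, h⟩ := id hY
  refine .of_add c (stabilizes_of_forall_mem (finite_setOf_prime_eq_colon_sup_pow_smul I A B) ?_
    fun p ↦ ?_)
  · intro n p hp
    obtain ⟨hp, w, -, hw⟩ := mem_associatedPrimes_subquotient.1 hp
    exact ⟨hp, n, w, by rwa [h] at hw⟩
  · obtain ⟨m, hm⟩ := hX.stabilizes_mem_associatedPrimes hY p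
    exact .of_eventually_const m fun n hn ↦ hm (c + n) (by omega)

end AssociatedPrimes

/-! ### Depth and regular sequences -/

section Depth

open RingTheory.Sequence

variable {R : Type*} [CommRing R] {J : Ideal R}

/-- Reducing modulo `a` and modulo `b` may be done in either order. -/
def quotSMulTopComm (N : Type*) [AddCommGroup N] [Module R N] (a b : R) :
    QuotSMulTop a (QuotSMulTop b N) ≃ₗ[R] QuotSMulTop b (QuotSMulTop a N) :=
  have h : ∀ c d : R, d • (⊤ : Submodule R (QuotSMulTop c N)) =
      (d • (⊤ : Submodule R N)).map (c • (⊤ : Submodule R N)).mkQ := fun c d ↦ by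
    rw [Submodule.map_pointwise_smul, Submodule.map_top, Submodule.range_mkQ]
  Submodule.quotEquivOfEq _ _ (h b a) ≪≫ₗ
    Submodule.quotientQuotientEquivQuotientSup _ _ ≪≫ₗ
    Submodule.quotEquivOfEq _ _ (sup_comm _ _) ≪≫ₗ
    (Submodule.quotientQuotientEquivQuotientSup _ _).symm ≪≫ₗ
    Submodule.quotEquivOfEq _ _ (h a b).symm

lemma smul_top_eq_top_congr {N N' : Type*} [AddCommGroup N] [Module R N] [AddCommGroup N']
    [Module R N'] (e : N ≃ₗ[R] N') :
    J • (⊤ : Submodule R N) = ⊤ ↔ J • (⊤ : Submodule R N') = ⊤ := by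
  have h : ∀ K : Submodule R N, K.map e.toLinearMap = ⊤ ↔ K = ⊤ := fun K ↦ by
    rw [← (Submodule.map_injective_of_injective (f := e.toLinearMap) e.injective).eq_iff (b := ⊤),
      Submodule.map_top, LinearEquiv.range]
  rw [← h, Submodule.map_smul'', (h ⊤).2 rfl]

lemma depth_congr {N N' : Type*} [AddCommGroup N] [Module R N] [AddCommGroup N']
    [Module R N'] (e : N ≃ₗ[R] N') : depth J N = depth J N' := by
  simp only [depth, smul_top_eq_top_congr e, e.isRegular_congr]

variable (J) in
/-- The module `N` has no nonzero element annihilated by `J`. -/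
def AnnihilatedTrivial (N : Type*) [AddCommGroup N] [Module R N] : Prop :=
  ∀ u : N, (∀ a ∈ J, a • u = 0) → u = 0

lemma AnnihilatedTrivial.prod {N N' : Type*} [AddCommGroup N] [Module R N] [AddCommGroup N']
    [Module R N'] (h : AnnihilatedTrivial J N) (h' : AnnihilatedTrivial J N') :
    AnnihilatedTrivial J (N × N') := fun u hu ↦
  Prod.ext (h u.1 fun a ha ↦ congrArg Prod.fst (hu a ha))
    (h' u.2 fun a ha ↦ congrArg Prod.snd (hu a ha))

lemma annihilatedTrivial_of_isSMulRegular {N : Type*} [AddCommGroup N] [Module R N] {z : R}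
    (hz : z ∈ J) (h : IsSMulRegular N z) : AnnihilatedTrivial J N :=
  fun _ hu ↦ h.right_eq_zero_of_smul (hu z hz)

/-- Prime avoidance for the associated primes of `N`. -/
lemma AnnihilatedTrivial.exists_isSMulRegular [IsNoetherianRing R] {N : Type*} [AddCommGroup N]
    [Module R N] [Module.Finite R N] (h : AnnihilatedTrivial J N) :
    ∃ z ∈ J, IsSMulRegular N z := by
  by_contra! hz
  have hsub : (J : Set R) ⊆ ⋃ p ∈ associatedPrimes R N, (p : Set R) := by
    rw [biUnion_associatedPrimes_eq_compl_regular]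
    exact fun z hzJ ↦ hz z hzJ
  obtain ⟨p, hp, hle⟩ := (J.subset_union_prime_finite (associatedPrimes.finite R N) (f := id) 0 0
    fun _ h _ _ ↦ h.isPrime).1 hsub
  obtain ⟨hp, u, rfl⟩ := isAssociatedPrime_iff.1 hp
  refine hp.ne_top ((Ideal.eq_top_iff_one _).2 ?_)
  simp [h u fun a ha ↦ by simpa using Submodule.mem_colon_singleton.1 (hle ha)]

/-- If `J u ⊆ y N`, then `x u = y v` for some `v`. As `y` is regular, `J v ⊆ x N`, so that `v ∈ x N`
by assumption; as `x` is regular, `u ∈ y N`. -/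
lemma AnnihilatedTrivial.quotSMulTop_of_isSMulRegular {N : Type*} [AddCommGroup N] [Module R N]
    {x y : R} (hxJ : x ∈ J) (hx : IsSMulRegular N x) (hy : IsSMulRegular N y)
    (h : AnnihilatedTrivial J (QuotSMulTop x N)) : AnnihilatedTrivial J (QuotSMulTop y N) := by
  have hmem : ∀ (c : R) (u : N),
      (Submodule.Quotient.mk u : QuotSMulTop c N) = 0 ↔ ∃ w, c • w = u := fun c u ↦ by
    rw [Submodule.Quotient.mk_eq_zero, Submodule.mem_smul_pointwise_iff_exists]
    simp
  intro u hu
  obtain ⟨u, rfl⟩ := Submodule.Quotient.mk_surjective _ u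
  simp only [← Submodule.Quotient.mk_smul, hmem] at hu
  obtain ⟨v, hv⟩ := hu x hxJ
  have hv0 : (Submodule.Quotient.mk v : QuotSMulTop x N) = 0 := by
    refine h _ fun a ha ↦ ?_
    obtain ⟨w, hw⟩ := hu a ha
    rw [← Submodule.Quotient.mk_smul, hmem]
    refine ⟨w, hy ?_⟩
    simp only
    rw [smul_comm y x, hw, smul_comm y a, hv, smul_comm]
  obtain ⟨w, rfl⟩ := (hmem _ _).1 hv0
  refine (hmem _ _).2 ⟨w, hx ?_⟩
  simp only
  rw [smul_comm, hv]

lemma isSMulRegular_quotSMulTop_swap {N : Type*} [AddCommGroup N] [Module R N] {a b : R}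
    (ha : IsSMulRegular N a) (hab : IsSMulRegular (QuotSMulTop a N) b) :
    IsSMulRegular (QuotSMulTop b N) a := by
  rw [isSMulRegular_quotient_iff_mem_of_smul_mem] at hab ⊢
  simp only [Submodule.mem_smul_pointwise_iff_exists, Submodule.mem_top, true_and] at hab ⊢
  rintro u ⟨v, hv⟩
  obtain ⟨w, rfl⟩ := hab v ⟨u, hv.symm⟩
  exact ⟨w, ha (by simp only; rw [smul_comm, hv])⟩

/-- Exchange property of regular sequences: if `J` contains a weakly regular sequence of length
`k + 1` on `N` and an `N`-regular element `x`, then it contains a weakly regular sequence of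
length `k` on `N / x N`. -/
lemma exists_isWeaklyRegular_quotSMulTop [IsNoetherianRing R] (k : ℕ) {N : Type*} [AddCommGroup N]
    [Module R N] [Module.Finite R N] {x : R} (hxJ : x ∈ J) (hx : IsSMulRegular N x) {rs : List R}
    (hk : rs.length = k + 1) (hrs : ∀ r ∈ rs, r ∈ J) (h : IsWeaklyRegular N rs) :
    ∃ ss : List R, ss.length = k ∧ (∀ s ∈ ss, s ∈ J) ∧ IsWeaklyRegular (QuotSMulTop x N) ss := by
  induction k generalizing N x rs with
  | zero => exact ⟨[], rfl, by simp, .nil R _⟩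
  | succ k ih =>
    obtain _ | ⟨y, _ | ⟨y', rs⟩⟩ := rs
    · simp at hk
    · simp at hk
    simp only [List.mem_cons, forall_eq_or_imp] at hrs
    obtain ⟨hyJ, hyJ', hrs⟩ := hrs
    obtain ⟨hy, h⟩ := (isWeaklyRegular_cons_iff _ _ _).1 h
    have hy' := ((isWeaklyRegular_cons_iff _ _ _).1 h).1
    -- An element of `J` which is regular on `N`, on `N / x N` and on `N / y N`.
    have hPy := annihilatedTrivial_of_isSMulRegular hyJ' hy'
    have hPx := hPy.quotSMulTop_of_isSMulRegular hyJ hy hx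
    obtain ⟨z, hzJ, hz⟩ := ((annihilatedTrivial_of_isSMulRegular hxJ hx).prod
      (hPx.prod hPy)).exists_isSMulRegular
    have hzN : IsSMulRegular N z := hz.of_injective (LinearMap.inl R _ _) LinearMap.inl_injective
    have hz2 := hz.of_injective (LinearMap.inr R _ _) LinearMap.inr_injective
    have hzx : IsSMulRegular (QuotSMulTop x N) z :=
      hz2.of_injective (LinearMap.inl R _ _) LinearMap.inl_injective
    have hzy : IsSMulRegular (QuotSMulTop y N) z :=
      hz2.of_injective (LinearMap.inr R _ _) LinearMap.inr_injective
    obtain ⟨ss, hss, hssJ, hssR⟩ := ih hzJ hzy (rs := y' :: rs) (by simpa using hk)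
      (by simpa using ⟨hyJ', hrs⟩) h
    have hyss : IsWeaklyRegular (QuotSMulTop z N) (y :: ss) :=
      .cons (isSMulRegular_quotSMulTop_swap hy hzy)
        (((quotSMulTopComm N z y).isWeaklyRegular_congr ss).1 hssR)
    obtain ⟨ts, hts, htsJ, htsR⟩ := ih hxJ (isSMulRegular_quotSMulTop_swap hx hzx)
      (rs := y :: ss) (by simpa using hss) (by simpa using ⟨hyJ, hssJ⟩) hyss
    exact ⟨z :: ts, by simpa using hts, by simpa using ⟨hzJ, htsJ⟩,
      .cons hzx (((quotSMulTopComm N x z).isWeaklyRegular_congr ts).1 htsR)⟩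

section

variable {N : Type*} [AddCommGroup N] [Module R N]

lemma isRegular_of_smul_top_ne_top (hN : J • (⊤ : Submodule R N) ≠ ⊤) {rs : List R}
    (hrs : ∀ r ∈ rs, r ∈ J) (h : IsWeaklyRegular N rs) : IsRegular N rs where
  toIsWeaklyRegular := h
  top_ne_smul htop := hN <| top_le_iff.1 <| htop.le.trans <|
    Submodule.smul_mono_left (Ideal.span_le.2 hrs)

lemma quotSMulTop_smul_top_ne_top (hN : J • (⊤ : Submodule R N) ≠ ⊤) {x : R} (hx : x ∈ J) :
    J • (⊤ : Submodule R (QuotSMulTop x N)) ≠ ⊤ := by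
  intro h
  rw [← Submodule.range_mkQ, ← Submodule.map_top, ← Submodule.map_smul''] at h
  have h' := congrArg (Submodule.comap (x • (⊤ : Submodule R N)).mkQ) h
  rw [Submodule.comap_map_mkQ, Submodule.comap_map_mkQ, sup_top_eq, sup_eq_right.2] at h'
  · exact hN h'
  · rw [← Submodule.ideal_span_singleton_smul]
    exact Submodule.smul_mono_left ((Ideal.span_singleton_le_iff_mem J).2 hx)

lemma depth_eq_top (hN : J • (⊤ : Submodule R N) = ⊤) : depth J N = ⊤ := if_pos hN

lemma le_depth (hN : J • (⊤ : Submodule R N) ≠ ⊤) {rs : List R} (hrs : ∀ r ∈ rs, r ∈ J)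
    (h : IsWeaklyRegular N rs) : (rs.length : ℕ∞) ≤ depth J N := by
  rw [depth, if_neg hN]
  exact le_iSup₂_of_le rs ⟨hrs, isRegular_of_smul_top_ne_top hN hrs h⟩ le_rfl

lemma depth_le (hN : J • (⊤ : Submodule R N) ≠ ⊤) {d : ℕ∞}
    (h : ∀ rs : List R, (∀ r ∈ rs, r ∈ J) → IsWeaklyRegular N rs → (rs.length : ℕ∞) ≤ d) :
    depth J N ≤ d := by
  rw [depth, if_neg hN]
  exact iSup₂_le fun rs hrs ↦ h rs hrs.1 hrs.2.toIsWeaklyRegular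

lemma depth_eq_zero (hN : J • (⊤ : Submodule R N) ≠ ⊤) (h : ∀ z ∈ J, ¬ IsSMulRegular N z) :
    depth J N = 0 := by
  refine le_antisymm (depth_le hN fun rs hrs hreg ↦ ?_) zero_le
  obtain _ | ⟨y, rs⟩ := rs
  · simp
  · exact (h y (hrs y (by simp)) ((isWeaklyRegular_cons_iff _ _ _).1 hreg).1).elim

/-- Depth drops by exactly one modulo a regular element. -/
lemma depth_eq_depth_quotSMulTop_add_one [IsNoetherianRing R] [Module.Finite R N]
    (hN : J • (⊤ : Submodule R N) ≠ ⊤) {x : R} (hxJ : x ∈ J) (hx : IsSMulRegular N x) :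
    depth J N = depth J (QuotSMulTop x N) + 1 := by
  have hNx := quotSMulTop_smul_top_ne_top hN hxJ
  refine le_antisymm (depth_le hN fun rs hrs hreg ↦ ?_) ?_
  · obtain _ | ⟨y, rs⟩ := rs
    · simp
    · obtain ⟨ss, hss, hssJ, hssR⟩ :=
        exists_isWeaklyRegular_quotSMulTop rs.length hxJ hx (by simp) hrs hreg
      have := le_depth hNx hssJ hssR
      rw [hss] at this
      simpa using add_le_add_left this 1
  · have hcons : ∀ rs : List R, (∀ r ∈ rs, r ∈ J) → IsWeaklyRegular (QuotSMulTop x N) rs →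
        (rs.length : ℕ∞) + 1 ≤ depth J N := fun rs hrs hreg ↦ by
      simpa using le_depth hN (rs := x :: rs) (by simpa using ⟨hxJ, hrs⟩) (.cons hx hreg)
    rw [depth, if_neg hNx,
      ENat.biSup_add' ⟨[], by simp, isRegular_of_smul_top_ne_top hNx (by simp) (.nil R _)⟩]
    exact iSup₂_le fun rs hrs ↦ hcons rs hrs.1 hrs.2.toIsWeaklyRegular

end

end Depth

/-! ### Depth of subquotients of Rees type -/

section DepthOfFamilies

variable {R : Type*} [CommRing R] {W : Type*} [AddCommGroup W] [Module R W]

/-- For submodules `Y ≤ X`, the module `X / (Y + 𝔠 X)` is `X / Y` reduced modulo `𝔠`. -/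
def subquotientSupSmulEquiv {X Y : Submodule R W} (h : Y ≤ X) (𝔠 : Ideal R) :
    Subquotient X (Y ⊔ 𝔠 • X) ≃ₗ[R]
      Subquotient X Y ⧸ (𝔠 • ⊤ : Submodule R (Subquotient X Y)) :=
  have h₁ : (𝔠 • X).submoduleOf X = 𝔠 • ⊤ := by
    have hX : 𝔠 • X = (𝔠 • ⊤ : Submodule R X).map X.subtype := by
      rw [Submodule.map_smul'', Submodule.map_top, X.range_subtype]
    rw [hX, Submodule.submoduleOf, Submodule.comap_map_eq_of_injective X.injective_subtype]
  have h₂ : (𝔠 • ⊤ : Submodule R (Subquotient X Y)) =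
      (𝔠 • ⊤ : Submodule R X).map (Y.submoduleOf X).mkQ := by
    rw [Submodule.map_smul'', Submodule.map_top, Submodule.range_mkQ]
  Submodule.quotEquivOfEq _ _
      (by rw [Submodule.submoduleOf_sup_of_le h Submodule.smul_le_right, h₁]) ≪≫ₗ
    (Submodule.quotientQuotientEquivQuotientSup _ _).symm ≪≫ₗ
    Submodule.quotEquivOfEq _ _ h₂.symm

lemma isSMulRegular_iff_of_associatedPrimes_eq [IsNoetherianRing R] {N N' : Type*}
    [AddCommGroup N] [Module R N] [AddCommGroup N'] [Module R N']
    (h : associatedPrimes R N = associatedPrimes R N') (z : R) :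
    IsSMulRegular N z ↔ IsSMulRegular N' z := by
  have h' := (biUnion_associatedPrimes_eq_compl_regular R N).symm.trans
    ((congrArg (fun s : Set (Ideal R) ↦ ⋃ p ∈ s, (p : Set R)) h).trans
      (biUnion_associatedPrimes_eq_compl_regular R N'))
  exact Set.ext_iff.1 (compl_injective h') z

lemma smul_top_eq_top_iff_associatedPrimes_eq_empty [IsNoetherianRing R] {X Y : Submodule R W}
    (h : Y ≤ X) (J : Ideal R) : J • (⊤ : Submodule R (Subquotient X Y)) = ⊤ ↔
      associatedPrimes R (Subquotient X (Y ⊔ J • X)) = ∅ := by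
  rw [LinearEquiv.AssociatedPrimes.eq (subquotientSupSmulEquiv h J),
    ← Submodule.Quotient.subsingleton_iff]
  constructor
  · intro _
    exact associatedPrimes.eq_empty_of_subsingleton
  · intro he
    by_contra hs
    have := not_subsingleton_iff_nontrivial.1 hs
    exact (associatedPrimes.nonempty R _).ne_empty he

/-- The depths of the subquotients `X n / Y n` stabilize if `X` and `Y` are of Rees type. Since the
associated primes stabilize, an element of `J` regular on one of these modules with large `n` is
regular on all of them. Dividing by this element leads to a family of the same kind with smaller
depth; this process stops since the ideals generated by the elements found increase strictly. -/
theorem IsReesFamily.stabilizes_depth [IsNoetherianRing R] [Module.Finite R W] {I : Ideal R}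
    (J : Ideal R) {X Y : ℕ → Submodule R W} (hX : IsReesFamily I X) (hY : IsReesFamily I Y)
    (hYX : ∀ n, Y n ≤ X n) : Stabilizes fun n ↦ depth J (Subquotient (X n) (Y n)) := by
  suffices H : ∀ (𝔞 : Ideal R) (Y : ℕ → Submodule R W), IsReesFamily I Y → (∀ n, Y n ≤ X n) →
      (∀ n, 𝔞 • X n ≤ Y n) → Stabilizes fun n ↦ depth J (Subquotient (X n) (Y n)) from
    H ⊥ Y hY hYX fun n ↦ by simp
  intro 𝔞
  induction 𝔞 using WellFoundedGT.induction with
  | ind 𝔞 ih =>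
  intro Y hY hYX h𝔞
  obtain ⟨n₁, h₁⟩ := hX.stabilizes_associatedPrimes hY
  obtain ⟨n₂, h₂⟩ := hX.stabilizes_associatedPrimes (hY.sup (hX.smul J))
  have hJ : ∀ n ≥ n₂, J • (⊤ : Submodule R (Subquotient (X n) (Y n))) = ⊤ ↔
      associatedPrimes R (Subquotient (X n₂) (Y n₂ ⊔ J • X n₂)) = ∅ := fun n hn ↦ by
    rw [smul_top_eq_top_iff_associatedPrimes_eq_empty (hYX n)]
    exact iff_of_eq (congrArg (· = ∅) (h₂ n hn))
  by_cases h₀ : associatedPrimes R (Subquotient (X n₂) (Y n₂ ⊔ J • X n₂)) = ∅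
  · exact .of_eventually_const n₂ fun n hn ↦ depth_eq_top ((hJ n hn).2 h₀)
  replace hJ : ∀ n ≥ n₂, J • (⊤ : Submodule R (Subquotient (X n) (Y n))) ≠ ⊤ :=
    fun n hn h ↦ h₀ ((hJ n hn).1 h)
  have hreg : ∀ n ≥ n₁, ∀ z, IsSMulRegular (Subquotient (X n) (Y n)) z ↔
      IsSMulRegular (Subquotient (X n₁) (Y n₁)) z := fun n hn ↦
    isSMulRegular_iff_of_associatedPrimes_eq (h₁ n hn)
  by_cases hz : ∃ z ∈ J, IsSMulRegular (Subquotient (X n₁) (Y n₁)) z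
  swap
  · push Not at hz
    exact .of_eventually_const (max n₁ n₂) fun n hn ↦
      depth_eq_zero (hJ n (le_of_max_le_right hn)) fun z hzJ h ↦
        hz z hzJ ((hreg n (le_of_max_le_left hn) z).1 h)
  obtain ⟨z, hzJ, hz⟩ := hz
  have hlt : 𝔞 < 𝔞 ⊔ Ideal.span {z} := by
    refine left_lt_sup.2 fun hle ↦ hJ (max n₁ n₂) (le_max_right _ _) ?_
    -- Otherwise `z` would be both regular and zero on `X n / Y n`.
    have hzn := (hreg (max n₁ n₂) (le_max_left _ _) z).2 hz
    have : Subsingleton (Subquotient (X (max n₁ n₂)) (Y (max n₁ n₂))) := by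
      refine subsingleton_of_forall_eq 0 fun u ↦ hzn.right_eq_zero_of_smul ?_
      obtain ⟨w, rfl⟩ := Submodule.Quotient.mk_surjective _ u
      rw [← Submodule.Quotient.mk_smul, Submodule.Quotient.mk_eq_zero]
      exact h𝔞 _ (Submodule.smul_mem_smul (hle (Ideal.mem_span_singleton_self z)) w.2)
    exact Subsingleton.elim _ _
  have hY' := ih _ hlt (fun n ↦ Y n ⊔ Ideal.span {z} • X n) (hY.sup (hX.smul _))
    (fun n ↦ sup_le (hYX n) Submodule.smul_le_right)
    (fun n ↦ by rw [Submodule.sup_smul]; exact sup_le_sup_right (h𝔞 n) _)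
  refine (hY'.map (· + 1)).congr (max n₁ n₂) fun n hn ↦ ?_
  rw [depth_eq_depth_quotSMulTop_add_one (hJ n (le_of_max_le_right hn)) hzJ
    ((hreg n (le_of_max_le_left hn) z).2 hz), depth_congr ((subquotientSupSmulEquiv (hYX n) _) ≪≫ₗ
      Submodule.quotEquivOfEq _ _ (Submodule.ideal_span_singleton_smul z _))]

end DepthOfFamilies

/-! ### Coherent functors -/

section CoherentFunctors

variable {R : Type*} [CommRing R]

/-- Given linear maps `a` and `b` out of the same module, the subquotient `range a / Y` is
isomorphic to the target of `b` if `b` is surjective with kernel `a ⁻¹ Y`. -/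
lemma nonempty_subquotient_equiv {S W N : Type*} [AddCommGroup S] [Module R S] [AddCommGroup W]
    [Module R W] [AddCommGroup N] [Module R N] (a : S →ₗ[R] W) (b : S →ₗ[R] N)
    (hb : Function.Surjective b) {X Y : Submodule R W} (hX : LinearMap.range a = X)
    (h : ∀ s, a s ∈ Y ↔ b s = 0) : Nonempty (Subquotient X Y ≃ₗ[R] N) := by
  subst hX
  have hsurj : Function.Surjective ((Y.submoduleOf (LinearMap.range a)).mkQ ∘ₗ a.rangeRestrict) :=
    (Submodule.mkQ_surjective _).comp a.surjective_rangeRestrict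
  have hker : LinearMap.ker ((Y.submoduleOf (LinearMap.range a)).mkQ ∘ₗ a.rangeRestrict) =
      LinearMap.ker b := by
    ext s
    rw [LinearMap.mem_ker, LinearMap.mem_ker, ← h, LinearMap.comp_apply, Submodule.mkQ_apply,
      Submodule.Quotient.mk_eq_zero]
    rfl
  exact ⟨(LinearMap.quotKerEquivOfSurjective _ hsurj).symm ≪≫ₗ
    Submodule.quotEquivOfEq _ _ hker ≪≫ₗ LinearMap.quotKerEquivOfSurjective b hb⟩

variable {M N K L E E' : Type*} [AddCommGroup M] [Module R M] [AddCommGroup N] [Module R N]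
  [AddCommGroup K] [Module R K] [AddCommGroup L] [Module R L] [AddCommGroup E] [Module R E]
  [AddCommGroup E'] [Module R E']

/-- The pairs `(g, h)` of linear maps `g : E → M` and `h : K → N` such that `g` takes values in
`X` and lifts `h` along `π : E → K` and `q : X → N`. -/
def liftPairs {X : Submodule R M} (q : X →ₗ[R] N) (π : E →ₗ[R] K) :
    Submodule R ((E →ₗ[R] M) × (K →ₗ[R] N)) where
  carrier := {gh | ∀ r, ∃ x : X, (x : M) = gh.1 r ∧ q x = gh.2 (π r)}
  zero_mem' := fun r ↦ ⟨0, by simp⟩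
  add_mem' := by
    intro s t hs ht r
    obtain ⟨x, hx, hqx⟩ := hs r
    obtain ⟨y, hy, hqy⟩ := ht r
    exact ⟨x + y, by simp [hx, hy, hqx, hqy]⟩
  smul_mem' := by
    intro a s hs r
    obtain ⟨x, hx, hqx⟩ := hs r
    exact ⟨a • x, by simp [hx, hqx]⟩

/-- The maps `E → X ⊆ M` which send `ker π` to `Y`; for `π : E → K` surjective, these are the ones
inducing a map `K → X / Y`. -/
def inducingMaps (π : E →ₗ[R] K) (X Y : Submodule R M) : Submodule R (E →ₗ[R] M) :=
  Submodule.compatibleMaps ⊤ X ⊓ Submodule.compatibleMaps (LinearMap.ker π) Y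

lemma mem_inducingMaps {π : E →ₗ[R] K} {X Y : Submodule R M} {g : E →ₗ[R] M} :
    g ∈ inducingMaps π X Y ↔ (∀ r, g r ∈ X) ∧ ∀ r, π r = 0 → g r ∈ Y :=
  and_congr ⟨fun h r ↦ h (Submodule.mem_top (x := r)), fun h r _ ↦ h r⟩ Iff.rfl

lemma exists_mem_liftPairs_of_projective [Module.Projective R E] {X : Submodule R M}
    {q : X →ₗ[R] N} (hq : Function.Surjective q) (π : E →ₗ[R] K) (h : K →ₗ[R] N) :
    ∃ g, (g, h) ∈ liftPairs q π := by
  obtain ⟨g, hg⟩ := Module.projective_lifting_property q (h ∘ₗ π) hq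
  exact ⟨X.subtype ∘ₗ g, fun r ↦ ⟨g r, rfl, LinearMap.congr_fun hg r⟩⟩

lemma mem_inducingMaps_iff_exists {X Y : Submodule R M} {q : X →ₗ[R] N}
    (hqY : LinearMap.ker q = Y.submoduleOf X) {π : E →ₗ[R] K} (hπ : Function.Surjective π)
    {g : E →ₗ[R] M} : g ∈ inducingMaps π X Y ↔ ∃ h, (g, h) ∈ liftPairs q π := by
  have hq0 : ∀ x : X, q x = 0 ↔ (x : M) ∈ Y := fun x ↦ by
    rw [← LinearMap.mem_ker, hqY]; rfl
  rw [mem_inducingMaps]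
  constructor
  · rintro ⟨hX, hY⟩
    let f : E →ₗ[R] N := q ∘ₗ g.codRestrict X hX
    have hf : LinearMap.ker π ≤ LinearMap.ker f := fun r hr ↦ (hq0 _).2 (hY r hr)
    refine ⟨(LinearMap.ker π).liftQ f hf ∘ₗ (π.quotKerEquivOfSurjective hπ).symm.toLinearMap,
      fun r ↦ ⟨⟨g r, hX r⟩, rfl, ?_⟩⟩
    have hr : (π.quotKerEquivOfSurjective hπ).symm (π r) = Submodule.Quotient.mk r := by
      rw [LinearEquiv.symm_apply_eq]; rfl
    rw [LinearMap.comp_apply, LinearEquiv.coe_coe, hr]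
    rfl
  · rintro ⟨h, hgh⟩
    refine ⟨fun r ↦ ?_, fun r hr ↦ ?_⟩
    · obtain ⟨x, hx, -⟩ := hgh r
      exact hx ▸ x.2
    · obtain ⟨x, hx, hqx⟩ := hgh r
      rw [← hx, ← hq0, hqx]
      simp [hr]

/-- Let `N = X / Y` with `Y ≤ X ≤ M`. A presentation of a module `Q` as the cokernel of
`Hom (L, N) → Hom (K, N)`, induced by `α : K → L`, realizes `Q` as a subquotient of `Hom (E, M)`,
where `E → K` and `E' → L` are surjections from projective modules and `C : E → E'` lifts `α`. -/
lemma nonempty_inducingMaps_equiv [Module.Projective R E] [Module.Projective R E']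
    {X Y : Submodule R M} {q : X →ₗ[R] N} (hq : Function.Surjective q)
    (hqY : LinearMap.ker q = Y.submoduleOf X) {π : E →ₗ[R] K} (hπ : Function.Surjective π)
    {ρ : E' →ₗ[R] L} (hρ : Function.Surjective ρ) {α : K →ₗ[R] L} {C : E →ₗ[R] E'}
    (hC : ρ ∘ₗ C = α ∘ₗ π) {Q : Type*} [AddCommGroup Q] [Module R Q] {ψ : (K →ₗ[R] N) →ₗ[R] Q}
    (hψ : Function.Surjective ψ) (hψα : ∀ h, ψ h = 0 ↔ ∃ h' : L →ₗ[R] N, h' ∘ₗ α = h) :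
    Nonempty (Subquotient (inducingMaps π X Y)
      ((inducingMaps ρ X Y).map (LinearMap.lcomp R M C) ⊔ Submodule.compatibleMaps ⊤ Y)
      ≃ₗ[R] Q) := by
  have hq0 : ∀ x : X, q x = 0 ↔ (x : M) ∈ Y := fun x ↦ by
    rw [← LinearMap.mem_ker, hqY]; rfl
  have hC' : ∀ r, ρ (C r) = α (π r) := LinearMap.congr_fun hC
  refine nonempty_subquotient_equiv
    (LinearMap.fst R _ _ ∘ₗ (liftPairs q π).subtype)
    (ψ ∘ₗ LinearMap.snd R _ _ ∘ₗ (liftPairs q π).subtype) ?_ ?_ ?_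
  · refine hψ.comp fun h ↦ ?_
    obtain ⟨g, hg⟩ := exists_mem_liftPairs_of_projective hq π h
    exact ⟨⟨(g, h), hg⟩, rfl⟩
  · ext g
    rw [mem_inducingMaps_iff_exists hqY hπ]
    constructor
    · rintro ⟨⟨⟨g, h⟩, hgh⟩, rfl⟩
      exact ⟨h, hgh⟩
    · rintro ⟨h, hgh⟩
      exact ⟨⟨(g, h), hgh⟩, rfl⟩
  · rintro ⟨⟨g, h⟩, hgh⟩
    change g ∈ _ ↔ ψ h = 0
    rw [hψα, Submodule.mem_sup]
    constructor
    · rintro ⟨_, ⟨g', hg', rfl⟩, y, hy, hsum⟩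
      obtain ⟨h', hgh'⟩ := (mem_inducingMaps_iff_exists hqY hρ).1 hg'
      refine ⟨h', LinearMap.ext fun k ↦ ?_⟩
      obtain ⟨r, rfl⟩ := hπ k
      obtain ⟨x, hx, hqx⟩ := hgh r
      obtain ⟨x', hx', hqx'⟩ := hgh' (C r)
      rw [LinearMap.comp_apply, ← hC', ← hqx', ← hqx, eq_comm, ← sub_eq_zero, ← map_sub, hq0]
      have hyr : x - x' = y r := by
        rw [hx, hx', ← hsum]
        simp
      rw [Submodule.coe_sub, hyr]
      exact hy Submodule.mem_top
    · rintro ⟨h', rfl⟩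
      obtain ⟨g', hgh'⟩ := exists_mem_liftPairs_of_projective hq ρ h'
      refine ⟨_, ⟨g', (mem_inducingMaps_iff_exists hqY hρ).2 ⟨h', hgh'⟩, rfl⟩, g - g' ∘ₗ C,
        fun r _ ↦ ?_, by ext; simp⟩
      obtain ⟨x, hx, hqx⟩ := hgh r
      obtain ⟨x', hx', hqx'⟩ := hgh' (C r)
      rw [Submodule.mem_comap, LinearMap.sub_apply, LinearMap.comp_apply, ← hx, ← hx',
        ← Submodule.coe_sub, ← hq0, map_sub, hqx, hqx', hC', sub_eq_zero]
      rfl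

lemma inducingMaps_sup_le {X Y : Submodule R M} (hYX : Y ≤ X) {π : E →ₗ[R] K} {ρ : E' →ₗ[R] L}
    {α : K →ₗ[R] L} {C : E →ₗ[R] E'} (hC : ρ ∘ₗ C = α ∘ₗ π) :
    (inducingMaps ρ X Y).map (LinearMap.lcomp R M C) ⊔ Submodule.compatibleMaps ⊤ Y ≤
      inducingMaps π X Y := by
  refine sup_le ?_ fun g hg ↦ mem_inducingMaps.2
    ⟨fun r ↦ hYX (hg Submodule.mem_top), fun r _ ↦ hg Submodule.mem_top⟩
  rintro _ ⟨g, hg, rfl⟩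
  obtain ⟨hX, hY⟩ := mem_inducingMaps.1 hg
  refine mem_inducingMaps.2 ⟨fun r ↦ hX _, fun r hr ↦ hY _ ?_⟩
  have := LinearMap.congr_fun hC r
  simpa [hr] using this

section ReesFamily

variable [IsNoetherianRing R] [Module.Finite R M] [Module.Finite R E] {I : Ideal R}
  {X Y : ℕ → Submodule R M}

lemma IsReesFamily.compatibleMaps (P : Submodule R E) (hX : IsReesFamily I X) :
    IsReesFamily I fun n ↦ Submodule.compatibleMaps P (X n) := by
  obtain ⟨s, hs⟩ := (IsNoetherian.noetherian P : P.FG)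
  convert finset_inf s fun r ↦ hX.comap (LinearMap.applyₗ (R := R) (M₂ := M) r) using 2 with n
  ext g
  rw [Submodule.mem_finsetInf]
  change P ≤ (X n).comap g ↔ _
  rw [← hs, Submodule.span_le]
  rfl

lemma IsReesFamily.inducingMaps (π : E →ₗ[R] K) (hX : IsReesFamily I X) (hY : IsReesFamily I Y) :
    IsReesFamily I fun n ↦ inducingMaps π (X n) (Y n) :=
  (hX.compatibleMaps ⊤).inf (hY.compatibleMaps _)

end ReesFamily

end CoherentFunctors

section

variable {R : Type u} [CommRing R] [IsNoetherianRing R]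

/-- By the Yoneda lemma, `h_L ⟶ h_K` is induced by a linear map `α : K → L`. Hence a coherent
functor has the form `N ↦ coker (Hom (L, N) → Hom (K, N))`. -/
lemma IsCoherent.exists_presentation {F : FGModuleCat.{v} R ⥤ FGModuleCat.{v} R}
    (hF : IsCoherent F) : ∃ (K L : FGModuleCat.{v} R) (α : K →ₗ[R] L), ∀ N : FGModuleCat.{v} R,
      ∃ ψ : (K →ₗ[R] N) →ₗ[R] F.obj N, Function.Surjective ψ ∧
        ∀ h, ψ h = 0 ↔ ∃ h' : L →ₗ[R] N, h' ∘ₗ α = h := by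
  obtain ⟨L, K, φ, ψ, h⟩ := hF
  let α : K →ₗ[R] L := (φ.app L).hom.hom (LinearMap.id : L →ₗ[R] L)
  have hφ : ∀ (N : FGModuleCat.{v} R) (h' : L →ₗ[R] N), (φ.app N).hom.hom h' = h' ∘ₗ α := by
    intro N h'
    have hnat := φ.naturality (FGModuleCat.ofHom h' : L ⟶ N)
    have := LinearMap.congr_fun (congrArg (fun f ↦ f.hom.hom) hnat) (LinearMap.id : L →ₗ[R] L)
    exact this
  refine ⟨K, L, α, fun N ↦ ⟨(ψ.app N).hom.hom, (h N).2, fun k ↦ ?_⟩⟩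
  exact ((h N).1 k).trans (exists_congr fun h' ↦ iff_of_eq (congrArg (· = k) (hφ N h')))

/-- If `X` and `Y ≤ X` are of Rees type and `F` is coherent, then the modules `F (X n / Y n)`
are again subquotients of Rees type, so that their associated primes and depths stabilize. -/
theorem IsCoherent.stabilizes {F : FGModuleCat.{v} R ⥤ FGModuleCat.{v} R} (hF : IsCoherent F)
    {M : Type*} [AddCommGroup M] [Module R M] [Module.Finite R M] {I : Ideal R} (J : Ideal R)
    {X Y : ℕ → Submodule R M} (hX : IsReesFamily I X) (hY : IsReesFamily I Y)
    (hYX : ∀ n, Y n ≤ X n) (N : ℕ → FGModuleCat.{v} R) (q : ∀ n, X n →ₗ[R] N n)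
    (hq : ∀ n, Function.Surjective (q n))
    (hqY : ∀ n, LinearMap.ker (q n) = (Y n).submoduleOf (X n)) :
    Stabilizes (fun n ↦ associatedPrimes R (F.obj (N n))) ∧
      Stabilizes fun n ↦ depth J (F.obj (N n)) := by
  obtain ⟨K, L, α, hα⟩ := hF.exists_presentation
  obtain ⟨k, π, hπ⟩ := Module.Finite.exists_fin' R K
  obtain ⟨l, ρ, hρ⟩ := Module.Finite.exists_fin' R L
  obtain ⟨C, hC⟩ := Module.projective_lifting_property ρ (α ∘ₗ π) hρ
  have hX' := hX.inducingMaps π hY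
  have hY' := ((hX.inducingMaps ρ hY).map (LinearMap.lcomp R M C)).sup (hY.compatibleMaps ⊤)
  have e : ∀ n, Nonempty (Subquotient (inducingMaps π (X n) (Y n))
      ((inducingMaps ρ (X n) (Y n)).map (LinearMap.lcomp R M C) ⊔
        Submodule.compatibleMaps ⊤ (Y n)) ≃ₗ[R] F.obj (N n)) := fun n ↦ by
    obtain ⟨ψ, hψ, hψα⟩ := hα (N n)
    exact nonempty_inducingMaps_equiv (hq n) (hqY n) hπ hρ hC hψ hψα
  exact ⟨(hX'.stabilizes_associatedPrimes hY').congr 0 fun n _ ↦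
      (LinearEquiv.AssociatedPrimes.eq (e n).some).symm,
    (hX'.stabilizes_depth J hY' fun n ↦ inducingMaps_sup_le (hYX n) hC).congr 0 fun n _ ↦
      (depth_congr (e n).some).symm⟩

end

end AsymptoticStability

theorem theorem1p7 {R : Type u} [CommRing R] [IsNoetherianRing R] (I J : Ideal R)
    (M : Type v) [AddCommGroup M] [Module R M] [Module.Finite R M]
    (F : FGModuleCat.{v} R ⥤ FGModuleCat.{v} R) [F.Additive] [F.Linear R] (hF : IsCoherent F) :
    (Stabilizes (fun n : ℕ => associatedPrimes R
        (F.obj (FGModuleCat.of R (M ⧸ (I ^ n • (⊤ : Submodule R M)))))) ∧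
      Stabilizes (fun n : ℕ => associatedPrimes R
        (F.obj (FGModuleCat.of R
          (Subquotient (I ^ (n - 1) • (⊤ : Submodule R M)) (I ^ n • (⊤ : Submodule R M)))))) ∧
      Stabilizes (fun n : ℕ => depth J
        (F.obj (FGModuleCat.of R (M ⧸ (I ^ n • (⊤ : Submodule R M)))))) ∧
      Stabilizes (fun n : ℕ => depth J
        (F.obj (FGModuleCat.of R
          (Subquotient (I ^ (n - 1) • (⊤ : Submodule R M)) (I ^ n • (⊤ : Submodule R M))))))) ∧
    ∀ M' : Submodule R M,
      Stabilizes (fun n : ℕ => associatedPrimes R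
        (F.obj (FGModuleCat.of R (M ⧸ (I ^ n • M'))))) ∧
      Stabilizes (fun n : ℕ => associatedPrimes R
        (F.obj (FGModuleCat.of R (Subquotient (I ^ n • (⊤ : Submodule R M)) (I ^ n • M'))))) ∧
      Stabilizes (fun n : ℕ => depth J
        (F.obj (FGModuleCat.of R (M ⧸ (I ^ n • M'))))) ∧
      Stabilizes (fun n : ℕ => depth J
        (F.obj (FGModuleCat.of R
          (Subquotient (I ^ n • (⊤ : Submodule R M)) (I ^ n • M'))))) := by
  have general (M' : Submodule R M) :=
    hF.stabilizes J (.const (I := I) ⊤) (.pow_smul M') (fun _ ↦ le_top)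
      (fun n ↦ FGModuleCat.of R (M ⧸ I ^ n • M'))
      (fun n ↦ (I ^ n • M').mkQ ∘ₗ (⊤ : Submodule R M).subtype)
      (fun n ↦ (Submodule.mkQ_surjective _).comp fun x ↦ ⟨⟨x, Submodule.mem_top⟩, rfl⟩)
      (fun n ↦ by rw [LinearMap.ker_comp, Submodule.ker_mkQ, Submodule.submoduleOf])
  have graded (M' : Submodule R M) :=
    hF.stabilizes J (.pow_smul (I := I) ⊤) (.pow_smul M')
      (fun n ↦ smul_mono_right _ le_top)
      (fun n ↦ FGModuleCat.of R (Subquotient (I ^ n • (⊤ : Submodule R M)) (I ^ n • M')))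
      (fun n ↦ Submodule.mkQ _) (fun n ↦ Submodule.mkQ_surjective _) (fun n ↦ Submodule.ker_mkQ _)
  -- At `n = 0` the truncated exponent `n - 1` is `0`; the sequence has the right form from `n = 1`.
  have hpred : IsReesFamily I fun n ↦ I ^ (n - 1) • (⊤ : Submodule R M) :=
    ⟨1, ⊥, ⊤, fun n ↦ by simp⟩
  have consecutive :=
    hF.stabilizes J hpred (.pow_smul ⊤)
      (fun n ↦ Submodule.smul_mono_left (Ideal.pow_le_pow_right (Nat.sub_le n 1)))
      (fun n ↦ FGModuleCat.of R
        (Subquotient (I ^ (n - 1) • (⊤ : Submodule R M)) (I ^ n • (⊤ : Submodule R M))))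
      (fun n ↦ Submodule.mkQ _) (fun n ↦ Submodule.mkQ_surjective _) (fun n ↦ Submodule.ker_mkQ _)
  exact ⟨⟨(general ⊤).1, consecutive.1, (general ⊤).2, consecutive.2⟩,
    fun M' ↦ ⟨(general M').1, (graded M').1, (general M').2, (graded M').2⟩⟩
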